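/- Let $\mathcal{DM}$ be the direct mapping that sends a triple $(\mathbf R,\Sigma,I)$ ($\mathbf R$ a relational schema, $\Sigma$ a set of primary keys and foreign keys over $\mathbf R$, $I$ an instance of $\mathbf R$, possibly with $\mathtt{NULL}$ values) to the RDF graph with OWL vocabulary generated by the following Datalog program, for a given base IRI and given identifiers of the tuples (distinct tuples of the same relation having distinct identifiers). A relation $R$ is \emph{binary} if it has exactly two attributes $A,B$, these form its primary key, each of them alone is the attribute of exactly one single-attribute foreign key of $R$, pointing to relations $S,T\neq R$, they do not form a two-attribute foreign key of $R$, and no one- or two-attribute foreign key points to $R$. Every relation that is not binary becomes an OWL class, each of its attributes a datatype property with that class as domain, and each of its foreign keys an object property with the class of the relation as domain and the class of the referenced relation (if that is not binary) as range. Every tuple of a class relation gets an identifier: the IRI $\text{base}\,R\,\#A_1{=}v_1,\dots,A_n{=}v_n$ built from its primary key values (if these are not $\mathtt{NULL}$), or a blank node if $R$ has no primary key. For every tuple there are a triple typing its identifier with the class of $R$, triples linking it along foreign keys (and along binary relations) to the identifiers of the tuples it references, and one triple with a literal for each non-$\mathtt{NULL}$ attribute value. A direct mapping $\mathcal M$ is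 \emph{semantics preserving} if for every relational schema $\mathbf R$, every set $\Sigma$ of primary keys and foreign keys over $\mathbf R$ and every instance $I$ of $\mathbf R$: $I\models\Sigma$ if and only if the RDF graph $\mathcal M(\mathbf R,\Sigma,I)$ is consistent under OWL semantics, i.e. is satisfied by some OWL 2 interpretation (without built-in datatypes). Then $\mathcal{DM}$ is not semantics preserving. In particular, for the schema with the single relation $\mathtt{STUDENT}(\mathtt{SID},\mathtt{NAME})$, with $\Sigma$ consisting of the primary key $\mathtt{STUDENT}[\mathtt{SID}]$ only, and for the instance with the two tuples $(1,\mathtt{John})$ and $(1,\mathtt{Peter})$, the key is violated, but the image under $\mathcal{DM}$ is consistent under OWL semantics. -/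

import Mathlib

/-! ## Strings -/

/-- Strings: finite sequences of Unicode characters. -/
abbrev Str := List Char

/-- The string with the given Unicode code points. -/
def str (codes : List ℕ) : Str := codes.map Char.ofNat

/-- The string `#`. -/
def sHash : Str := str [35]
/-- The string `,`. -/
def sComma : Str := str [44]
/-- The string `=`. -/
def sEq : Str := str [61]
/-- The string `_:`. -/
def sBlank : Str := str [95, 58]

/-! ## Relational databases -/

namespace RelDB

/-- Tuples over a set `U` of attributes.  The domain of constants is the countably infinite set of
strings, and `none` is the reserved symbol NULL. -/
abbrev Tuple (U : Finset Str) := {A // A ∈ U} → Option Str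

/-- The value `t.A` (only meant for `A ∈ U`). -/
def Tuple.val {U : Finset Str} (t : Tuple U) (A : Str) : Option Str :=
  if h : A ∈ U then t ⟨A, h⟩ else none

/-- A relational schema: finitely many relation names, each with a nonempty finite set of
attributes. -/
structure Schema where
  rels : Finset Str
  att : Str → Finset Str
  att_nonempty : ∀ R ∈ rels, (att R).Nonempty

/-- An instance: a finite set of tuples for every relation name of the schema. -/
structure Instance (S₀ : Schema) where
  rel : (R : Str) → Finset (Tuple (S₀.att R))
  rel_eq_empty : ∀ R, R ∉ S₀.rels → rel R = ∅

/-- Keys `R[A₁,…,Aₘ]` and foreign keys `R[A₁,…,Aₘ] ⊆ S[B₁,…,Bₘ]`. -/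
inductive Constraint where
  | key (R : Str) (A : List Str)
  | fkey (R : Str) (A : List Str) (S : Str) (B : List Str)

/-- `A` lists the elements of a nonempty set of attributes of the relation name `R`. -/
def Schema.IsAttList (S₀ : Schema) (R : Str) (A : List Str) : Prop :=
  R ∈ S₀.rels ∧ A ≠ [] ∧ A.Nodup ∧ ∀ a ∈ A, a ∈ S₀.att R

/-- The constraint is a key or a foreign key over the schema. -/
def Constraint.Over (S₀ : Schema) : Constraint → Prop
  | .key R A => S₀.IsAttList R A
  | .fkey R A S B => S₀.IsAttList R A ∧ S₀.IsAttList S B ∧ A.length = B.length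

/-- `Sig` is a set of primary keys and foreign keys over the schema. -/
def IsPKFKSet (S₀ : Schema) (Sig : Finset Constraint) : Prop :=
  (∀ c ∈ Sig, c.Over S₀) ∧
  ∀ R A B, Constraint.key R A ∈ Sig → Constraint.key R B ∈ Sig → A = B

/-- Satisfaction of a key: no nulls in the key attributes, and no two tuples agree on them. -/
def Instance.SatKey {S₀ : Schema} (I : Instance S₀) (R : Str) (A : List Str) : Prop :=
  (∀ t ∈ I.rel R, ∀ a ∈ A, t.val a ≠ none) ∧
  ∀ t₁ ∈ I.rel R, ∀ t₂ ∈ I.rel R, (∀ a ∈ A, t₁.val a = t₂.val a) → t₁ = t₂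

/-- Satisfaction of a constraint. -/
def Instance.SatConstraint {S₀ : Schema} (I : Instance S₀) : Constraint → Prop
  | .key R A => I.SatKey R A
  | .fkey R A S B => I.SatKey S B ∧
      ∀ t ∈ I.rel R, (∃ a ∈ A, t.val a = none) ∨
        ∃ s ∈ I.rel S, ∀ p ∈ A.zip B, t.val p.1 = s.val p.2

/-- The inputs `(R, Σ, I)` of direct mappings. -/
structure Database where
  schema : Schema
  sig : Finset Constraint
  sig_ok : IsPKFKSet schema sig
  inst : Instance schema

/-- `I ⊨ Σ`. -/
def Database.Sat (X : Database) : Prop := ∀ c ∈ X.sig, X.inst.SatConstraint c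

end RelDB

/-! ## RDF graphs -/

namespace RDF

/-- The reserved RDF, RDFS and OWL 2 vocabulary, without built-in datatypes and facets. -/
inductive Vocab where
  -- RDF
  | rdfType | rdfProperty | rdfList | rdfNil | rdfFirst | rdfRest | rdfValue
  | rdfSubject | rdfPredicate | rdfObject | rdfStatement | rdfAlt | rdfBag | rdfSeq
  | rdfMembership (n : ℕ) -- the container membership property `rdf:_(n+1)`
  -- RDFS
  | rdfsResource | rdfsClass | rdfsLiteral | rdfsDatatype | rdfsContainer
  | rdfsContainerMembershipProperty | rdfsMember | rdfsSubClassOf | rdfsSubPropertyOf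
  | rdfsDomain | rdfsRange | rdfsComment | rdfsLabel | rdfsSeeAlso | rdfsIsDefinedBy
  -- OWL classes
  | owlAllDifferent | owlAllDisjointClasses | owlAllDisjointProperties | owlAnnotation
  | owlAnnotationProperty | owlAsymmetricProperty | owlAxiom | owlClass | owlDataRange
  | owlDatatypeProperty | owlDeprecatedClass | owlDeprecatedProperty | owlFunctionalProperty
  | owlInverseFunctionalProperty | owlIrreflexiveProperty | owlNamedIndividual
  | owlNegativePropertyAssertion | owlNothing | owlObjectProperty | owlOntology
  | owlOntologyProperty | owlReflexiveProperty | owlRestriction | owlSymmetricProperty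
  | owlThing | owlTransitiveProperty
  -- OWL properties
  | owlAllValuesFrom | owlAnnotatedProperty | owlAnnotatedSource | owlAnnotatedTarget
  | owlAssertionProperty | owlBackwardCompatibleWith | owlBottomDataProperty
  | owlBottomObjectProperty | owlCardinality | owlComplementOf | owlDatatypeComplementOf
  | owlDeprecated | owlDifferentFrom | owlDisjointUnionOf | owlDisjointWith
  | owlDistinctMembers | owlEquivalentClass | owlEquivalentProperty | owlHasKey | owlHasSelf
  | owlHasValue | owlImports | owlIncompatibleWith | owlIntersectionOf | owlInverseOf
  | owlMaxCardinality | owlMaxQualifiedCardinality | owlMembers | owlMinCardinality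
  | owlMinQualifiedCardinality | owlOnClass | owlOnDataRange | owlOnDatatype | owlOneOf
  | owlOnProperties | owlOnProperty | owlPriorVersion | owlPropertyChainAxiom
  | owlPropertyDisjointWith | owlQualifiedCardinality | owlSameAs | owlSomeValuesFrom
  | owlSourceIndividual | owlTargetIndividual | owlTargetValue | owlTopDataProperty
  | owlTopObjectProperty | owlUnionOf | owlVersionInfo | owlVersionIRI | owlWithRestrictions

/-- IRIs: the reserved vocabulary, and all other IRIs, which are given as strings. -/
inductive IRI where
  | vocab (v : Vocab)
  | other (s : Str)

/-- Literals: plain literals, and the numerals and truth values that the RDF syntax of OWL needs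
for cardinality and self restrictions. -/
inductive Literal where
  | plain (s : Str)
  | nat (n : ℕ)
  | bool (b : Bool)

/-- IRIs and blank nodes. -/
inductive Resource where
  | iri (i : IRI)
  | blank (s : Str)

/-- IRIs, blank nodes and literals. -/
inductive Term where
  | res (r : Resource)
  | lit (l : Literal)

/-- RDF triples: the subject is an IRI or a blank node, the predicate is an IRI, and the object is
an IRI, a blank node or a literal. -/
structure Triple where
  subj : Resource
  pred : IRI
  obj : Term

/-- An RDF graph is a finite set of RDF triples. -/
structure Graph where
  triples : Set Triple
  finite : triples.Finite

/-! ## The RDF-based semantics of OWL 2 -/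

open Vocab

/-- Interpretations.  `R` is the set of resources, `IP` the set of properties, `LV` the set of
literal values, `ext p` the extension of the property `p`, `iri` and `lit` the denotations of
IRIs and of literals; distinct literals have distinct values.  (As the vocabulary is countable and
the conditions below are expressible with countable conjunctions and disjunctions, larger
universes would not make more graphs consistent.) -/
structure Interp where
  R : Type
  IP : Set R
  LV : Set R
  ext : R → R → R → Prop
  ext_IP : ∀ p x y, ext p x y → p ∈ IP
  iri : IRI → R
  lit : Literal → R
  lit_injective : Function.Injective lit
  lit_LV : ∀ l, lit l ∈ LV

namespace Interp

variable (I : Interp)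

/-- Denotation of a vocabulary term. -/
def den (v : Vocab) : I.R := I.iri (.vocab v)

/-- Extension of a vocabulary property. -/
def P (v : Vocab) : I.R → I.R → Prop := I.ext (I.den v)

/-- Class extension of a resource. -/
def cext (c : I.R) : Set I.R := {x | I.P rdfType x c}

/-- Class extension of a vocabulary class. -/
def C (v : Vocab) : Set I.R := I.cext (I.den v)

/-- The set of classes. -/
def IC : Set I.R := I.C rdfsClass
/-- The set of datatypes. -/
def IDC : Set I.R := I.C rdfsDatatype
/-- The set of ontologies. -/
def IX : Set I.R := I.C owlOntology
/-- The set of sequences. -/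
def ISEQ : Set I.R := I.C rdfList
/-- The set of nonnegative integers. -/
def INNI : Set I.R := Set.range fun n => I.lit (.nat n)

/-- `s` is a sequence (an RDF list) of the given resources. -/
inductive IsSeq : I.R → List I.R → Prop
  | nil : IsSeq (I.den rdfNil) []
  | cons {s a t : I.R} {l : List I.R} :
      I.P rdfFirst s a → I.P rdfRest s t → IsSeq t l → IsSeq s (a :: l)

/-- `y` is reachable from `x` along the chain of the given properties. -/
def Chain : List I.R → I.R → I.R → Prop
  | [], x, y => x = y
  | p :: l, x, y => ∃ z, I.ext p x z ∧ Chain l z y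

end Interp

/-- The axiomatic triples of RDF and RDFS. -/
inductive Axiomatic : Vocab → Vocab → Vocab → Prop
  | property {v} (h : v ∈ [rdfType, rdfSubject, rdfPredicate, rdfObject, rdfFirst, rdfRest,
      rdfValue]) : Axiomatic v rdfType rdfProperty
  | membership (n : ℕ) : Axiomatic (rdfMembership n) rdfType rdfProperty
  | nil : Axiomatic rdfNil rdfType rdfList
  | domain {v w} (h : (v, w) ∈ [(rdfType, rdfsResource), (rdfsDomain, rdfProperty),
      (rdfsRange, rdfProperty), (rdfsSubPropertyOf, rdfProperty), (rdfsSubClassOf, rdfsClass),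
      (rdfSubject, rdfStatement), (rdfPredicate, rdfStatement), (rdfObject, rdfStatement),
      (rdfsMember, rdfsResource), (rdfFirst, rdfList), (rdfRest, rdfList),
      (rdfsSeeAlso, rdfsResource), (rdfsIsDefinedBy, rdfsResource), (rdfsComment, rdfsResource),
      (rdfsLabel, rdfsResource), (rdfValue, rdfsResource)]) : Axiomatic v rdfsDomain w
  | range {v w} (h : (v, w) ∈ [(rdfType, rdfsClass), (rdfsDomain, rdfsClass),
      (rdfsRange, rdfsClass), (rdfsSubPropertyOf, rdfProperty), (rdfsSubClassOf, rdfsClass),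
      (rdfSubject, rdfsResource), (rdfPredicate, rdfsResource), (rdfObject, rdfsResource),
      (rdfsMember, rdfsResource), (rdfFirst, rdfsResource), (rdfRest, rdfList),
      (rdfsSeeAlso, rdfsResource), (rdfsIsDefinedBy, rdfsResource), (rdfsComment, rdfsLiteral),
      (rdfsLabel, rdfsLiteral), (rdfValue, rdfsResource)]) : Axiomatic v rdfsRange w
  | subClass {v w} (h : (v, w) ∈ [(rdfAlt, rdfsContainer), (rdfBag, rdfsContainer),
      (rdfSeq, rdfsContainer), (rdfsContainerMembershipProperty, rdfProperty),
      (rdfsDatatype, rdfsClass)]) : Axiomatic v rdfsSubClassOf w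
  | isDefinedBy : Axiomatic rdfsIsDefinedBy rdfsSubPropertyOf rdfsSeeAlso
  | membershipType (n : ℕ) :
      Axiomatic (rdfMembership n) rdfType rdfsContainerMembershipProperty
  | membershipDomain (n : ℕ) : Axiomatic (rdfMembership n) rdfsDomain rdfsResource
  | membershipRange (n : ℕ) : Axiomatic (rdfMembership n) rdfsRange rdfsResource

namespace Interp

variable (I : Interp)

/-- The conditions of RDF and RDFS.  Those on domains, ranges, subclasses and subproperties are
contained in the (stronger) OWL conditions below. -/
structure RDFSConditions : Prop where
  axiomatic : ∀ s p o, Axiomatic s p o → I.P p (I.den s) (I.den o)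
  property : I.C rdfProperty = I.IP
  resource : I.C rdfsResource = Set.univ
  literal : I.C rdfsLiteral = I.LV
  membership : ∀ p ∈ I.C rdfsContainerMembershipProperty,
    I.P rdfsSubPropertyOf p (I.den rdfsMember)
  datatype : ∀ d ∈ I.IDC, I.P rdfsSubClassOf d (I.den rdfsLiteral)

/-- The vocabulary term denotes a class, with extension contained in `S`. -/
def ClassSub (v : Vocab) (S : Set I.R) : Prop := I.den v ∈ I.IC ∧ I.C v ⊆ S

/-- The vocabulary term denotes a class, with extension `S`. -/
def ClassEq (v : Vocab) (S : Set I.R) : Prop := I.den v ∈ I.IC ∧ I.C v = S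

/-- The vocabulary term denotes a property, with extension contained in `S × T`. -/
def PropSub (v : Vocab) (S T : Set I.R) : Prop :=
  I.den v ∈ I.IP ∧ ∀ x y, I.P v x y → x ∈ S ∧ y ∈ T

/-- The OWL 2 conditions on the vocabulary classes. -/
structure ClassConditions : Prop where
  cAllDifferent : I.ClassSub owlAllDifferent Set.univ
  cAllDisjointClasses : I.ClassSub owlAllDisjointClasses Set.univ
  cAllDisjointProperties : I.ClassSub owlAllDisjointProperties Set.univ
  cAnnotation : I.ClassSub owlAnnotation Set.univ
  cAnnotationProperty : I.ClassSub owlAnnotationProperty I.IP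
  cAsymmetricProperty : I.ClassSub owlAsymmetricProperty I.IP
  cAxiom : I.ClassSub owlAxiom Set.univ
  cRdfsClass : I.ClassEq rdfsClass I.IC
  cClass : I.ClassEq owlClass I.IC
  cDataRange : I.ClassEq owlDataRange I.IDC
  cDatatype : I.ClassSub rdfsDatatype I.IC
  cDatatypeProperty : I.ClassSub owlDatatypeProperty I.IP
  cDeprecatedClass : I.ClassSub owlDeprecatedClass I.IC
  cDeprecatedProperty : I.ClassSub owlDeprecatedProperty I.IP
  cFunctionalProperty : I.ClassSub owlFunctionalProperty I.IP
  cInverseFunctionalProperty : I.ClassSub owlInverseFunctionalProperty I.IP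
  cIrreflexiveProperty : I.ClassSub owlIrreflexiveProperty I.IP
  cLiteral : I.ClassEq rdfsLiteral I.LV
  cNamedIndividual : I.ClassSub owlNamedIndividual Set.univ
  cNegativePropertyAssertion : I.ClassSub owlNegativePropertyAssertion Set.univ
  cNothing : I.ClassEq owlNothing ∅
  cObjectProperty : I.ClassEq owlObjectProperty I.IP
  cOntology : I.ClassSub owlOntology Set.univ
  cOntologyProperty : I.ClassSub owlOntologyProperty I.IP
  cProperty : I.ClassEq rdfProperty I.IP
  cReflexiveProperty : I.ClassSub owlReflexiveProperty I.IP
  cResource : I.ClassEq rdfsResource Set.univ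
  cRestriction : I.ClassSub owlRestriction I.IC
  cSymmetricProperty : I.ClassSub owlSymmetricProperty I.IP
  cThing : I.ClassEq owlThing Set.univ
  cTransitiveProperty : I.ClassSub owlTransitiveProperty I.IP

/-- The OWL 2 conditions on the vocabulary properties. -/
structure PropertyConditions : Prop where
  pAllValuesFrom : I.PropSub owlAllValuesFrom (I.C owlRestriction) I.IC
  pAnnotatedProperty : I.PropSub owlAnnotatedProperty Set.univ Set.univ
  pAnnotatedSource : I.PropSub owlAnnotatedSource Set.univ Set.univ
  pAnnotatedTarget : I.PropSub owlAnnotatedTarget Set.univ Set.univ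
  pAssertionProperty :
    I.PropSub owlAssertionProperty (I.C owlNegativePropertyAssertion) I.IP
  pBackwardCompatibleWith : I.PropSub owlBackwardCompatibleWith I.IX I.IX ∧
    I.den owlBackwardCompatibleWith ∈ I.C owlOntologyProperty
  pBottomDataProperty : I.den owlBottomDataProperty ∈ I.C owlDatatypeProperty ∧
    ∀ x y, ¬ I.P owlBottomDataProperty x y
  pBottomObjectProperty : I.den owlBottomObjectProperty ∈ I.IP ∧
    ∀ x y, ¬ I.P owlBottomObjectProperty x y
  pCardinality : I.PropSub owlCardinality (I.C owlRestriction) I.INNI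
  pComment : I.PropSub rdfsComment Set.univ I.LV ∧
    I.den rdfsComment ∈ I.C owlAnnotationProperty
  pComplementOf : I.PropSub owlComplementOf I.IC I.IC
  pDatatypeComplementOf : I.PropSub owlDatatypeComplementOf I.IDC I.IDC
  pDeprecated : I.PropSub owlDeprecated Set.univ Set.univ ∧
    I.den owlDeprecated ∈ I.C owlAnnotationProperty
  pDifferentFrom : I.PropSub owlDifferentFrom Set.univ Set.univ
  pDisjointUnionOf : I.PropSub owlDisjointUnionOf I.IC I.ISEQ
  pDisjointWith : I.PropSub owlDisjointWith I.IC I.IC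
  pDistinctMembers : I.PropSub owlDistinctMembers (I.C owlAllDifferent) I.ISEQ
  pEquivalentClass : I.PropSub owlEquivalentClass I.IC I.IC
  pEquivalentProperty : I.PropSub owlEquivalentProperty I.IP I.IP
  pHasKey : I.PropSub owlHasKey I.IC I.ISEQ
  pHasSelf : I.PropSub owlHasSelf (I.C owlRestriction) Set.univ
  pHasValue : I.PropSub owlHasValue (I.C owlRestriction) Set.univ
  pImports : I.PropSub owlImports I.IX I.IX ∧ I.den owlImports ∈ I.C owlOntologyProperty
  pIncompatibleWith : I.PropSub owlIncompatibleWith I.IX I.IX ∧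
    I.den owlIncompatibleWith ∈ I.C owlOntologyProperty
  pIntersectionOf : I.PropSub owlIntersectionOf I.IC I.ISEQ
  pInverseOf : I.PropSub owlInverseOf I.IP I.IP
  pIsDefinedBy : I.PropSub rdfsIsDefinedBy Set.univ Set.univ ∧
    I.den rdfsIsDefinedBy ∈ I.C owlAnnotationProperty
  pLabel : I.PropSub rdfsLabel Set.univ I.LV ∧ I.den rdfsLabel ∈ I.C owlAnnotationProperty
  pMaxCardinality : I.PropSub owlMaxCardinality (I.C owlRestriction) I.INNI
  pMaxQualifiedCardinality : I.PropSub owlMaxQualifiedCardinality (I.C owlRestriction) I.INNI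
  pMembers : I.PropSub owlMembers Set.univ I.ISEQ
  pMinCardinality : I.PropSub owlMinCardinality (I.C owlRestriction) I.INNI
  pMinQualifiedCardinality : I.PropSub owlMinQualifiedCardinality (I.C owlRestriction) I.INNI
  pOnClass : I.PropSub owlOnClass (I.C owlRestriction) I.IC
  pOnDataRange : I.PropSub owlOnDataRange (I.C owlRestriction) I.IDC
  pOnDatatype : I.PropSub owlOnDatatype I.IDC I.IDC
  pOneOf : I.PropSub owlOneOf I.IC I.ISEQ
  pOnProperties : I.PropSub owlOnProperties (I.C owlRestriction) I.ISEQ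
  pOnProperty : I.PropSub owlOnProperty (I.C owlRestriction) I.IP
  pPriorVersion : I.PropSub owlPriorVersion I.IX I.IX ∧
    I.den owlPriorVersion ∈ I.C owlOntologyProperty
  pPropertyChain : I.PropSub owlPropertyChainAxiom I.IP I.ISEQ
  pPropertyDisjointWith : I.PropSub owlPropertyDisjointWith I.IP I.IP
  pQualifiedCardinality : I.PropSub owlQualifiedCardinality (I.C owlRestriction) I.INNI
  pSameAs : I.PropSub owlSameAs Set.univ Set.univ
  pSeeAlso : I.PropSub rdfsSeeAlso Set.univ Set.univ ∧
    I.den rdfsSeeAlso ∈ I.C owlAnnotationProperty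
  pSomeValuesFrom : I.PropSub owlSomeValuesFrom (I.C owlRestriction) I.IC
  pSourceIndividual :
    I.PropSub owlSourceIndividual (I.C owlNegativePropertyAssertion) Set.univ
  pTargetIndividual :
    I.PropSub owlTargetIndividual (I.C owlNegativePropertyAssertion) Set.univ
  pTargetValue : I.PropSub owlTargetValue (I.C owlNegativePropertyAssertion) I.LV
  pTopDataProperty : I.den owlTopDataProperty ∈ I.C owlDatatypeProperty ∧
    ∀ x y, I.P owlTopDataProperty x y ↔ y ∈ I.LV
  pTopObjectProperty : I.den owlTopObjectProperty ∈ I.IP ∧ ∀ x y, I.P owlTopObjectProperty x y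
  pUnionOf : I.PropSub owlUnionOf I.IC I.ISEQ
  pVersionInfo : I.PropSub owlVersionInfo Set.univ Set.univ ∧
    I.den owlVersionInfo ∈ I.C owlAnnotationProperty
  pVersionIRI : I.PropSub owlVersionIRI I.IX I.IX ∧
    I.den owlVersionIRI ∈ I.C owlOntologyProperty
  pWithRestrictions : I.PropSub owlWithRestrictions I.IDC I.ISEQ

/-- The OWL 2 conditions on class expressions. -/
structure ExpressionConditions : Prop where
  complementOf : ∀ z c, I.P owlComplementOf z c ↔
    z ∈ I.IC ∧ c ∈ I.IC ∧ I.cext z = (I.cext c)ᶜ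
  datatypeComplementOf : ∀ z d, I.P owlDatatypeComplementOf z d ↔
    z ∈ I.IDC ∧ d ∈ I.IDC ∧ I.cext z = I.LV \ I.cext d
  intersectionOf : ∀ z s l, I.IsSeq s l → (I.P owlIntersectionOf z s ↔
    z ∈ I.IC ∧ (∀ c ∈ l, c ∈ I.IC) ∧ I.cext z = {x | ∀ c ∈ l, x ∈ I.cext c})
  unionOf : ∀ z s l, I.IsSeq s l → (I.P owlUnionOf z s ↔
    z ∈ I.IC ∧ (∀ c ∈ l, c ∈ I.IC) ∧ I.cext z = {x | ∃ c ∈ l, x ∈ I.cext c})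
  oneOf : ∀ z s l, I.IsSeq s l → (I.P owlOneOf z s ↔ z ∈ I.IC ∧ I.cext z = {x | x ∈ l})
  someValuesFrom : ∀ z c p, I.P owlSomeValuesFrom z c → I.P owlOnProperty z p →
    I.cext z = {x | ∃ y, I.ext p x y ∧ y ∈ I.cext c}
  allValuesFrom : ∀ z c p, I.P owlAllValuesFrom z c → I.P owlOnProperty z p →
    I.cext z = {x | ∀ y, I.ext p x y → y ∈ I.cext c}
  hasValue : ∀ z a p, I.P owlHasValue z a → I.P owlOnProperty z p →
    I.cext z = {x | I.ext p x a}
  hasSelf : ∀ z p, I.P owlHasSelf z (I.lit (.bool true)) → I.P owlOnProperty z p →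
    I.cext z = {x | I.ext p x x}
  minCardinality : ∀ z n p, I.P owlMinCardinality z (I.lit (.nat n)) → I.P owlOnProperty z p →
    I.cext z = {x | (n : ℕ∞) ≤ {y | I.ext p x y}.encard}
  maxCardinality : ∀ z n p, I.P owlMaxCardinality z (I.lit (.nat n)) → I.P owlOnProperty z p →
    I.cext z = {x | {y | I.ext p x y}.encard ≤ (n : ℕ∞)}
  cardinality : ∀ z n p, I.P owlCardinality z (I.lit (.nat n)) → I.P owlOnProperty z p →
    I.cext z = {x | {y | I.ext p x y}.encard = (n : ℕ∞)}
  minQualifiedCardinality : ∀ z n p c, I.P owlMinQualifiedCardinality z (I.lit (.nat n)) →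
    I.P owlOnProperty z p → I.P owlOnClass z c →
    I.cext z = {x | (n : ℕ∞) ≤ {y | I.ext p x y ∧ y ∈ I.cext c}.encard}
  maxQualifiedCardinality : ∀ z n p c, I.P owlMaxQualifiedCardinality z (I.lit (.nat n)) →
    I.P owlOnProperty z p → I.P owlOnClass z c →
    I.cext z = {x | {y | I.ext p x y ∧ y ∈ I.cext c}.encard ≤ (n : ℕ∞)}
  qualifiedCardinality : ∀ z n p c, I.P owlQualifiedCardinality z (I.lit (.nat n)) →
    I.P owlOnProperty z p → I.P owlOnClass z c →
    I.cext z = {x | {y | I.ext p x y ∧ y ∈ I.cext c}.encard = (n : ℕ∞)}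
  minDataCardinality : ∀ z n p d, I.P owlMinQualifiedCardinality z (I.lit (.nat n)) →
    I.P owlOnProperty z p → I.P owlOnDataRange z d →
    I.cext z = {x | (n : ℕ∞) ≤ {y | y ∈ I.LV ∧ I.ext p x y ∧ y ∈ I.cext d}.encard}
  maxDataCardinality : ∀ z n p d, I.P owlMaxQualifiedCardinality z (I.lit (.nat n)) →
    I.P owlOnProperty z p → I.P owlOnDataRange z d →
    I.cext z = {x | {y | y ∈ I.LV ∧ I.ext p x y ∧ y ∈ I.cext d}.encard ≤ (n : ℕ∞)}
  dataCardinality : ∀ z n p d, I.P owlQualifiedCardinality z (I.lit (.nat n)) →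
    I.P owlOnProperty z p → I.P owlOnDataRange z d →
    I.cext z = {x | {y | y ∈ I.LV ∧ I.ext p x y ∧ y ∈ I.cext d}.encard = (n : ℕ∞)}

/-- The OWL 2 conditions on axioms. -/
structure AxiomConditions : Prop where
  subClassOf : ∀ c d, I.P rdfsSubClassOf c d ↔ c ∈ I.IC ∧ d ∈ I.IC ∧ I.cext c ⊆ I.cext d
  subPropertyOf : ∀ p q, I.P rdfsSubPropertyOf p q ↔
    p ∈ I.IP ∧ q ∈ I.IP ∧ ∀ x y, I.ext p x y → I.ext q x y
  domain : ∀ p c, I.P rdfsDomain p c ↔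
    p ∈ I.IP ∧ c ∈ I.IC ∧ ∀ x y, I.ext p x y → x ∈ I.cext c
  range : ∀ p c, I.P rdfsRange p c ↔
    p ∈ I.IP ∧ c ∈ I.IC ∧ ∀ x y, I.ext p x y → y ∈ I.cext c
  equivalentClass : ∀ c d, I.P owlEquivalentClass c d ↔
    c ∈ I.IC ∧ d ∈ I.IC ∧ I.cext c = I.cext d
  disjointWith : ∀ c d, I.P owlDisjointWith c d ↔
    c ∈ I.IC ∧ d ∈ I.IC ∧ Disjoint (I.cext c) (I.cext d)
  equivalentProperty : ∀ p q, I.P owlEquivalentProperty p q ↔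
    p ∈ I.IP ∧ q ∈ I.IP ∧ ∀ x y, I.ext p x y ↔ I.ext q x y
  propertyDisjointWith : ∀ p q, I.P owlPropertyDisjointWith p q ↔
    p ∈ I.IP ∧ q ∈ I.IP ∧ ∀ x y, ¬ (I.ext p x y ∧ I.ext q x y)
  disjointUnionOf : ∀ c s l, I.IsSeq s l → (I.P owlDisjointUnionOf c s ↔
    c ∈ I.IC ∧ (∀ d ∈ l, d ∈ I.IC) ∧ I.cext c = {x | ∃ d ∈ l, x ∈ I.cext d} ∧
      l.Pairwise fun d e => Disjoint (I.cext d) (I.cext e))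
  propertyChain : ∀ p s l, I.IsSeq s l → l ≠ [] → (I.P owlPropertyChainAxiom p s ↔
    p ∈ I.IP ∧ (∀ q ∈ l, q ∈ I.IP) ∧ ∀ x y, I.Chain l x y → I.ext p x y)
  inverseOf : ∀ p q, I.P owlInverseOf p q ↔
    p ∈ I.IP ∧ q ∈ I.IP ∧ ∀ x y, I.ext p x y ↔ I.ext q y x
  functional : ∀ p, p ∈ I.C owlFunctionalProperty ↔
    p ∈ I.IP ∧ ∀ x y z, I.ext p x y → I.ext p x z → y = z
  inverseFunctional : ∀ p, p ∈ I.C owlInverseFunctionalProperty ↔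
    p ∈ I.IP ∧ ∀ x y z, I.ext p x z → I.ext p y z → x = y
  reflexive : ∀ p, p ∈ I.C owlReflexiveProperty ↔ p ∈ I.IP ∧ ∀ x, I.ext p x x
  irreflexive : ∀ p, p ∈ I.C owlIrreflexiveProperty ↔ p ∈ I.IP ∧ ∀ x, ¬ I.ext p x x
  symmetric : ∀ p, p ∈ I.C owlSymmetricProperty ↔
    p ∈ I.IP ∧ ∀ x y, I.ext p x y → I.ext p y x
  asymmetric : ∀ p, p ∈ I.C owlAsymmetricProperty ↔
    p ∈ I.IP ∧ ∀ x y, I.ext p x y → ¬ I.ext p y x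
  transitive : ∀ p, p ∈ I.C owlTransitiveProperty ↔
    p ∈ I.IP ∧ ∀ x y z, I.ext p x y → I.ext p y z → I.ext p x z
  sameAs : ∀ a b, I.P owlSameAs a b ↔ a = b
  differentFrom : ∀ a b, I.P owlDifferentFrom a b ↔ a ≠ b
  hasKey : ∀ c s l, I.IsSeq s l → l ≠ [] → (I.P owlHasKey c s ↔
    c ∈ I.IC ∧ (∀ p ∈ l, p ∈ I.IP) ∧ ∀ x ∈ I.cext c, ∀ y ∈ I.cext c,
      (∀ p ∈ l, ∃ z, I.ext p x z ∧ I.ext p y z) → x = y)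
  allDifferent : ∀ z s l, I.IsSeq s l → z ∈ I.C owlAllDifferent →
    I.P owlMembers z s ∨ I.P owlDistinctMembers z s → l.Nodup
  allDisjointClasses : ∀ z s l, I.IsSeq s l → z ∈ I.C owlAllDisjointClasses →
    I.P owlMembers z s → (∀ c ∈ l, c ∈ I.IC) ∧
      l.Pairwise fun c d => Disjoint (I.cext c) (I.cext d)
  allDisjointProperties : ∀ z s l, I.IsSeq s l → z ∈ I.C owlAllDisjointProperties →
    I.P owlMembers z s → (∀ p ∈ l, p ∈ I.IP) ∧
      l.Pairwise fun p q => ∀ x y, ¬ (I.ext p x y ∧ I.ext q x y)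
  negativeAssertion : ∀ z a p b, I.P owlSourceIndividual z a → I.P owlAssertionProperty z p →
    I.P owlTargetIndividual z b ∨ I.P owlTargetValue z b → ¬ I.ext p a b

/-- OWL 2 RDF-based interpretations. -/
structure IsOWL : Prop where
  rdfs : I.RDFSConditions
  classes : I.ClassConditions
  properties : I.PropertyConditions
  expressions : I.ExpressionConditions
  axioms : I.AxiomConditions

/-- Denotation of IRIs and of blank nodes, where `β` interprets the blank nodes. -/
def resDen (β : Str → I.R) : Resource → I.R
  | .iri i => I.iri i
  | .blank s => β s

/-- Denotation of terms, where `β` interprets the blank nodes. -/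
def termDen (β : Str → I.R) : Term → I.R
  | .res r => I.resDen β r
  | .lit l => I.lit l

/-- `I` satisfies the graph `G`. -/
def Models (G : Graph) : Prop :=
  ∃ β : Str → I.R, ∀ t ∈ G.triples, I.ext (I.iri t.pred) (I.resDen β t.subj) (I.termDen β t.obj)

end Interp

/-- Consistency under OWL semantics: there is an OWL interpretation satisfying the graph. -/
def Graph.OWLConsistent (G : Graph) : Prop := ∃ I : Interp, I.IsOWL ∧ I.Models G

end RDF

/-! ## Direct mappings -/

open RelDB RDF

/-- Direct mappings: total functions from the inputs `(R, Σ, I)` to RDF graphs. -/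
abbrev DirectMapping := Database → Graph

/-- Semantics preservation: `I ⊨ Σ` iff the image of `(R, Σ, I)` is consistent. -/
def SemanticsPreserving (M : DirectMapping) : Prop :=
  ∀ X : Database, X.Sat ↔ (M X).OWLConsistent

/-- An assignment of identifiers to the tuples of each relation, distinct tuples of a relation
having distinct identifiers. -/
structure TupleIds where
  id : (R : Str) → {U : Finset Str} → Tuple U → Str
  id_injective : ∀ (R : Str) (U : Finset Str), Function.Injective (id R : Tuple U → Str)

/-- There are such assignments. -/
theorem TupleIds.nonempty : Nonempty TupleIds := by
  have hc : Countable Char := Function.Injective.countable (f := Char.toNat) fun a b hab =>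
    Char.ext (UInt32.toNat_inj.1 hab)
  have h : ∀ U : Finset Str, ∃ f : Tuple U → ℕ, Function.Injective f :=
    fun U => exists_injective_nat (Tuple U)
  choose f hf using h
  refine ⟨⟨fun _ U t => List.replicate (f U t) (Char.ofNat 97), fun _ U t t' htt' => hf U ?_⟩⟩
  simpa using congrArg List.length htt'

namespace DM

/-! The Datalog program of the direct mapping.  It is nonrecursive, and each intensional predicate
is given by the disjunction of the bodies of its rules. -/

section Program

variable (X : Database) (base : Str) (ι : TupleIds)

/-! ### Extensional predicates -/

/-- `Rel(r)` -/
def Rel (r : Str) : Prop := r ∈ X.schema.rels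

/-- `Attr(a, r)` -/
def Attr (a r : Str) : Prop := r ∈ X.schema.rels ∧ a ∈ X.schema.att r

/-- `PKₙ(a₁, …, aₙ, r)` -/
def PK (A : List Str) (r : Str) : Prop := Constraint.key r A ∈ X.sig

/-- `FKₙ(a₁, …, aₙ, r, b₁, …, bₙ, s)` -/
def FK (A : List Str) (r : Str) (B : List Str) (s : Str) : Prop :=
  Constraint.fkey r A s B ∈ X.sig

/-- `Value(v, a, t, r)`: `v` is the value (or NULL) of attribute `a` in the tuple with
identifier `t` of relation `r`. -/
def Value (v : Option Str) (a t r : Str) : Prop :=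
  Attr X a r ∧ ∃ τ ∈ X.inst.rel r, ι.id r τ = t ∧ τ.val a = v

/-! ### Binary relations, classes and properties -/

def ThreeAttr (r : Str) : Prop :=
  ∃ x y z, Attr X x r ∧ Attr X y r ∧ Attr X z r ∧ x ≠ y ∧ x ≠ z ∧ y ≠ z

def TwoFK (x y : Str) : Prop :=
  (∃ u₁ v₁ u₂ v₂, FK X [x] y [u₁] v₁ ∧ FK X [x] y [u₂] v₂ ∧ u₁ ≠ u₂) ∨
  (∃ u₁ v₁ u₂ v₂, FK X [x] y [u₁] v₁ ∧ FK X [x] y [u₂] v₂ ∧ v₁ ≠ v₂)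

def FKfrom (x y z : Str) : Prop :=
  (∃ u v w, FK X [x, y] z [u, v] w) ∨ (∃ u v w, FK X [y, x] z [u, v] w)

def FKto (x : Str) : Prop :=
  (∃ u y v, FK X [u] y [v] x) ∨ (∃ u₁ u₂ y v₁ v₂, FK X [u₁, u₂] y [v₁, v₂] x)

def BinRel (r a b s c t d : Str) : Prop :=
  PK X [a, b] r ∧ ¬ ThreeAttr X r ∧ FK X [a] r [c] s ∧ r ≠ s ∧ FK X [b] r [d] t ∧ r ≠ t ∧
  ¬ TwoFK X a r ∧ ¬ TwoFK X b r ∧ ¬ FKfrom X a b r ∧ ¬ FKto X r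

def IsBinRel (r : Str) : Prop := ∃ a b s c t d, BinRel X r a b s c t d

def Class (r : Str) : Prop := Rel X r ∧ ¬ IsBinRel X r

/-- `ObjP₂ₙ(x₁, …, xₙ, y₁, …, yₙ, s, t)` -/
def ObjP (A B : List Str) (s t : Str) : Prop := FK X A s B t ∧ ¬ IsBinRel X s

def DTP (a r : Str) : Prop := Attr X a r ∧ ¬ IsBinRel X r

/-! ### IRIs of classes and properties -/

def ClassIRI (r u : Str) : Prop := Class X r ∧ u = base ++ r

def DTPIRI (a r u : Str) : Prop := DTP X a r ∧ u = base ++ r ++ sHash ++ a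

/-- Object properties generated from binary relations. -/
def OPIRIbin (r a b s c t d u : Str) : Prop :=
  BinRel X r a b s c t d ∧
  u = base ++ r ++ sHash ++ a ++ sComma ++ b ++ sComma ++ c ++ sComma ++ d

/-- Object properties generated from foreign keys; the attributes `x₁, …, xₙ, y₁, …, yₙ` are
separated by commas. -/
def OPIRI (A B : List Str) (s t u : Str) : Prop :=
  ObjP X A B s t ∧ u = base ++ s ++ sComma ++ t ++ sHash ++ sComma.intercalate (A ++ B)

/-! ### Identifiers of tuples -/

/-- `A₁=V₁,…,Aₙ=Vₙ` -/
def keyString (A V : List Str) : Str :=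
  sComma.intercalate (List.zipWith (fun a v => a ++ sEq ++ v) A V)

/-- IRIs for the tuples of a relation with primary key `A₁, …, Aₙ`.  NULL is not a string, so that
the concatenation only exists if no `Vᵢ` is NULL. -/
def RowIRI (V A : List Str) (t r u : Str) : Prop :=
  PK X A r ∧ List.Forall₂ (fun v a => Value X ι (some v) a t r) V A ∧
  u = base ++ r ++ sHash ++ keyString A V

/-- Blank nodes for the tuples of a relation without a primary key. -/
def RowBlank (t r u : Str) : Prop := (∃ v a, Value X ι v a t r) ∧ u = sBlank ++ r ++ t

/-- `HasPKₙ(r)` -/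
def HasPK (n : ℕ) (r : Str) : Prop := ∃ A : List Str, 1 ≤ A.length ∧ A.length ≤ n ∧ PK X A r

/-- `ID(t, r, u)` -/
def TupleID (t r : Str) (u : Resource) : Prop :=
  (∃ A V x, Class X r ∧ RowIRI X base ι V A t r x ∧ u = .iri (.other x)) ∨
  (∃ x, Class X r ∧ ¬ HasPK X (X.schema.att r).card r ∧ RowBlank X ι t r x ∧ u = .blank x)

/-! ### Triples -/

/-- The RDF resource with a given IRI outside the reserved vocabulary. -/
def node (s : Str) : Resource := .iri (.other s)

/-- The vocabulary term as the object of a triple. -/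
def voc (v : Vocab) : Term := .res (.iri (.vocab v))

/-- The triples generated by the direct mapping. -/
inductive IsTriple : Triple → Prop
  | classDecl {r u} : ClassIRI X base r u →
      IsTriple ⟨node u, .vocab .rdfType, voc .owlClass⟩
  | objDecl {A B s t u} : OPIRI X base A B s t u →
      IsTriple ⟨node u, .vocab .rdfType, voc .owlObjectProperty⟩
  | objDomain {A B s t u w} : OPIRI X base A B s t u → ClassIRI X base s w →
      IsTriple ⟨node u, .vocab .rdfsDomain, .res (node w)⟩
  | objRange {A B s t u w} : OPIRI X base A B s t u → ClassIRI X base t w →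
      IsTriple ⟨node u, .vocab .rdfsRange, .res (node w)⟩
  | dataDecl {a r u} : DTPIRI X base a r u →
      IsTriple ⟨node u, .vocab .rdfType, voc .owlDatatypeProperty⟩
  | dataDomain {a r u w} : DTPIRI X base a r u → ClassIRI X base r w →
      IsTriple ⟨node u, .vocab .rdfsDomain, .res (node w)⟩
  | table {v a t r u w} : Value X ι v a t r → TupleID X base ι t r u → ClassIRI X base r w →
      IsTriple ⟨u, .vocab .rdfType, .res (node w)⟩
  | refBin {r a b s c t d v₁ v₂ t₁ t₂ t₃ u p w} :
      BinRel X r a b s c t d →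
      Value X ι v₁ a t₁ r → Value X ι v₁ c t₂ s → Value X ι v₂ b t₁ r → Value X ι v₂ d t₃ t →
      TupleID X base ι t₂ s u → OPIRIbin X base r a b s c t d p → TupleID X base ι t₃ t w →
      IsTriple ⟨u, .other p, .res w⟩
  | refFK {A B s t t₁ t₂ u p w} {V : List (Option Str)} :
      ObjP X A B s t →
      List.Forall₂ (fun v a => Value X ι v a t₁ s) V A →
      List.Forall₂ (fun v b => Value X ι v b t₂ t) V B →
      TupleID X base ι t₁ s u → TupleID X base ι t₂ t w → OPIRI X base A B s t p →
      IsTriple ⟨u, .other p, .res w⟩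
  | literal {a r t u p v} :
      DTP X a r → Value X ι (some v) a t r → TupleID X base ι t r u → DTPIRI X base a r p →
      IsTriple ⟨u, .other p, .lit (.plain v)⟩

/-! ### Only finitely many triples are generated -/

theorem finite_class : {u | ∃ r, ClassIRI X base r u}.Finite := by
  refine (X.schema.rels.finite_toSet.image (fun r => base ++ r)).subset ?_
  rintro u ⟨r, h, rfl⟩
  exact ⟨r, h.1, rfl⟩

theorem finite_dtp : {u | ∃ a r, DTPIRI X base a r u}.Finite := by
  refine (X.schema.rels.finite_toSet.biUnion fun r _ =>
    (X.schema.att r).finite_toSet.image fun a => base ++ r ++ sHash ++ a).subset ?_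
  rintro u ⟨a, r, h, rfl⟩
  exact Set.mem_biUnion (Finset.mem_coe.2 h.1.1) ⟨a, h.1.2, rfl⟩

theorem finite_op : {u | ∃ A B s t, OPIRI X base A B s t u}.Finite := by
  refine (X.sig.finite_toSet.image fun c => match c with
    | .key _ _ => []
    | .fkey s A t B =>
      base ++ s ++ sComma ++ t ++ sHash ++ sComma.intercalate (A ++ B)).subset ?_
  rintro u ⟨A, B, s, t, h, rfl⟩
  exact ⟨_, h.1, rfl⟩

theorem finite_opbin : {u | ∃ r a b s c t d, OPIRIbin X base r a b s c t d u}.Finite := by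
  refine ((X.sig.finite_toSet.prod (X.sig.finite_toSet.prod X.sig.finite_toSet)).image
    fun q => match q with
    | (.key r [a, b], .fkey _ _ _ [c], .fkey _ _ _ [d]) =>
      base ++ r ++ sHash ++ a ++ sComma ++ b ++ sComma ++ c ++ sComma ++ d
    | _ => []).subset ?_
  rintro u ⟨r, a, b, s, c, t, d, h, rfl⟩
  exact ⟨(.key r [a, b], .fkey r [a] s [c], .fkey r [b] t [d]),
    ⟨h.1, h.2.2.1, h.2.2.2.2.1⟩, rfl⟩

theorem finite_rows :
    {q : Str × Str | q.2 ∈ X.schema.rels ∧ ∃ τ ∈ X.inst.rel q.2, ι.id q.2 τ = q.1}.Finite := by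
  refine (X.schema.rels.finite_toSet.biUnion fun r _ =>
    (X.inst.rel r).finite_toSet.image fun τ => (ι.id r τ, r)).subset ?_
  rintro ⟨t, r⟩ ⟨hr, τ, hτ, ht⟩
  exact Set.mem_biUnion (Finset.mem_coe.2 hr) ⟨τ, hτ, Prod.ext ht rfl⟩

theorem Value.row {v a t r} (h : Value X ι v a t r) :
    (t, r) ∈ {q : Str × Str |
      q.2 ∈ X.schema.rels ∧ ∃ τ ∈ X.inst.rel q.2, ι.id q.2 τ = q.1} := by
  obtain ⟨h, τ, hτ, ht, -⟩ := h
  exact ⟨h.1, τ, hτ, ht⟩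

theorem Value.unique {v w a t r} (h : Value X ι v a t r) (h' : Value X ι w a t r) : v = w := by
  obtain ⟨-, τ, -, ht, hv⟩ := h
  obtain ⟨-, σ, -, hs, hw⟩ := h'
  have : τ = σ := ι.id_injective r _ (ht.trans hs.symm)
  rw [← hv, ← hw, this]

theorem forall₂_unique {t r} : ∀ {V W A : List Str},
    List.Forall₂ (fun v a => Value X ι (some v) a t r) V A →
    List.Forall₂ (fun v a => Value X ι (some v) a t r) W A → V = W
  | _, _, _, .nil, .nil => rfl
  | _, _, _, .cons h hs, .cons h' hs' => by
    rw [Option.some_injective _ (h.unique X ι h'), forall₂_unique hs hs']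

theorem finite_id : {u | ∃ t r, TupleID X base ι t r u}.Finite := by
  classical
  have h₁ : {x | ∃ V A t r, (∃ v a, Value X ι v a t r) ∧
      RowIRI X base ι V A t r x}.Finite := by
    have : {x | ∃ V A t r, (∃ v a, Value X ι v a t r) ∧ RowIRI X base ι V A t r x} ⊆
        ⋃ q ∈ {q : Str × Str | q.2 ∈ X.schema.rels ∧ ∃ τ ∈ X.inst.rel q.2, ι.id q.2 τ = q.1},
          ⋃ c ∈ (X.sig : Set Constraint),
            {x | ∃ A, c = .key q.2 A ∧ ∃ V, RowIRI X base ι V A q.1 q.2 x} := by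
      rintro x ⟨V, A, t, r, ⟨v, a, hv⟩, h⟩
      simp only [Set.mem_iUnion]
      exact ⟨(t, r), hv.row X ι, _, h.1, A, rfl, V, h⟩
    refine Set.Finite.subset ((finite_rows X ι).biUnion fun q _ =>
      X.sig.finite_toSet.biUnion fun c _ => Set.Subsingleton.finite ?_) this
    rintro x ⟨A, hA, V, -, hV, rfl⟩ y ⟨B, hB, W, -, hW, rfl⟩
    obtain rfl : A = B := by
      have := hA.symm.trans hB
      simpa using this
    rw [forall₂_unique X ι hV hW]
  have h₂ : {x | ∃ t r, RowBlank X ι t r x}.Finite := by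
    refine ((finite_rows X ι).image fun q => sBlank ++ q.2 ++ q.1).subset ?_
    rintro x ⟨t, r, ⟨v, a, hv⟩, rfl⟩
    exact ⟨(t, r), hv.row X ι, rfl⟩
  refine ((h₁.image node).union (h₂.image Resource.blank)).subset ?_
  rintro u ⟨t, r, ⟨A, V, x, -, h, rfl⟩ | ⟨x, -, -, h, rfl⟩⟩
  · refine Or.inl ⟨x, ⟨V, A, t, r, ?_, h⟩, rfl⟩
    have hne : A ≠ [] := (X.sig_ok.1 _ h.1).2.1
    cases h.2.1 with
    | nil => exact absurd rfl hne
    | cons hv _ => exact ⟨_, _, hv⟩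
  · exact Or.inr ⟨x, ⟨t, r, h⟩, rfl⟩

theorem finite_value : {v | ∃ a t r, Value X ι v a t r}.Finite := by
  refine (X.schema.rels.finite_toSet.biUnion fun r _ =>
    (X.schema.att r).finite_toSet.biUnion fun a _ =>
      (X.inst.rel r).finite_toSet.image fun τ => τ.val a).subset ?_
  rintro v ⟨a, t, r, h, τ, hτ, -, rfl⟩
  exact Set.mem_biUnion (Finset.mem_coe.2 h.1)
    (Set.mem_biUnion (Finset.mem_coe.2 h.2) ⟨τ, hτ, rfl⟩)

theorem finite_triples : {T | IsTriple X base ι T}.Finite := by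
  have hC := finite_class X base
  have hD := finite_dtp X base
  have hO := finite_op X base
  have hB := finite_opbin X base
  have hI := finite_id X base ι
  have hV := finite_value X ι
  have hS := (((hC.union hD).union hO).image node).union hI
  have hP := (((hD.union hO).union hB).image IRI.other).union
    (Set.toFinite {IRI.vocab .rdfType, IRI.vocab .rdfsDomain, IRI.vocab .rdfsRange})
  have hT := ((hS.image Term.res).union
    (Set.toFinite {voc .owlClass, voc .owlObjectProperty, voc .owlDatatypeProperty})).union
    (hV.image fun v => Term.lit (.plain (v.getD [])))
  refine ((hS.prod (hP.prod hT)).image fun q => Triple.mk q.1 q.2.1 q.2.2).subset ?_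
  rintro T h
  refine ⟨(T.subj, T.pred, T.obj), ?_, rfl⟩
  cases h with
  | classDecl h =>
    exact ⟨.inl ⟨_, .inl (.inl ⟨_, h⟩), rfl⟩, .inr (by simp), .inl (.inr (by simp))⟩
  | objDecl h =>
    exact ⟨.inl ⟨_, .inr ⟨_, _, _, _, h⟩, rfl⟩, .inr (by simp), .inl (.inr (by simp))⟩
  | objDomain h h' =>
    exact ⟨.inl ⟨_, .inr ⟨_, _, _, _, h⟩, rfl⟩, .inr (by simp),
      .inl (.inl ⟨_, .inl ⟨_, .inl (.inl ⟨_, h'⟩), rfl⟩, rfl⟩)⟩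
  | objRange h h' =>
    exact ⟨.inl ⟨_, .inr ⟨_, _, _, _, h⟩, rfl⟩, .inr (by simp),
      .inl (.inl ⟨_, .inl ⟨_, .inl (.inl ⟨_, h'⟩), rfl⟩, rfl⟩)⟩
  | dataDecl h =>
    exact ⟨.inl ⟨_, .inl (.inr ⟨_, _, h⟩), rfl⟩, .inr (by simp), .inl (.inr (by simp))⟩
  | dataDomain h h' =>
    exact ⟨.inl ⟨_, .inl (.inr ⟨_, _, h⟩), rfl⟩, .inr (by simp),
      .inl (.inl ⟨_, .inl ⟨_, .inl (.inl ⟨_, h'⟩), rfl⟩, rfl⟩)⟩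
  | table _ h h' =>
    exact ⟨.inr ⟨_, _, h⟩, .inr (by simp),
      .inl (.inl ⟨_, .inl ⟨_, .inl (.inl ⟨_, h'⟩), rfl⟩, rfl⟩)⟩
  | refBin _ _ _ _ _ h h' h'' =>
    exact ⟨.inr ⟨_, _, h⟩, .inl ⟨_, .inr ⟨_, _, _, _, _, _, _, h'⟩, rfl⟩,
      .inl (.inl ⟨_, .inr ⟨_, _, h''⟩, rfl⟩)⟩
  | refFK _ _ _ h h' h'' =>
    exact ⟨.inr ⟨_, _, h⟩, .inl ⟨_, .inl (.inr ⟨_, _, _, _, h''⟩), rfl⟩,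
      .inl (.inl ⟨_, .inr ⟨_, _, h'⟩, rfl⟩)⟩
  | literal _ h h' h'' =>
    exact ⟨.inr ⟨_, _, h'⟩, .inl ⟨_, .inl (.inl ⟨_, _, h''⟩), rfl⟩,
      .inr ⟨_, ⟨_, _, _, h⟩, rfl⟩⟩

end Program

end DM

/-- The direct mapping `DM`, for a given base IRI and given tuple identifiers. -/
def directMapping (base : Str) (ι : TupleIds) : DirectMapping :=
  fun X => ⟨{T | DM.IsTriple X base ι T}, DM.finite_triples X base ι⟩

/-! ## The example database -/

namespace Student

/-- The string `STUDENT`. -/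
def sSTUDENT : Str := str [83, 84, 85, 68, 69, 78, 84]
/-- The string `SID`. -/
def sSID : Str := str [83, 73, 68]
/-- The string `NAME`. -/
def sNAME : Str := str [78, 65, 77, 69]
/-- The string `1`. -/
def sOne : Str := str [49]
/-- The string `John`. -/
def sJohn : Str := str [74, 111, 104, 110]
/-- The string `Peter`. -/
def sPeter : Str := str [80, 101, 116, 101, 114]

/-- The schema with the single relation `STUDENT(SID, NAME)`. -/
def schema : Schema where
  rels := {sSTUDENT}
  att _ := {sSID, sNAME}
  att_nonempty _ _ := ⟨sSID, by simp⟩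

/-- The `STUDENT` tuple with `SID = 1` and the given name. -/
def tuple (name : Str) : Tuple {sSID, sNAME} :=
  fun A => if A.1 = sSID then some sOne else some name

/-- The two tuples `(1, John)` and `(1, Peter)`. -/
def tuples : Finset (Tuple {sSID, sNAME}) := {tuple sJohn, tuple sPeter}

/-- The instance with the tuples `(1, John)` and `(1, Peter)`. -/
def inst : Instance schema where
  rel R := if R = sSTUDENT then tuples else ∅
  rel_eq_empty R hR := if_neg (by simpa [schema] using hR)

/-- `SID` is the primary key of `STUDENT`, and there are no other constraints. -/
def database : Database where
  schema := schema
  sig := {.key sSTUDENT [sSID]}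
  sig_ok := by
    constructor
    · intro c hc
      obtain rfl := Finset.mem_singleton.1 hc
      refine ⟨by simp [schema], by simp, by simp, ?_⟩
      simp [schema]
    · intro R A B hA hB
      have hA := Finset.mem_singleton.1 hA
      have hB := Finset.mem_singleton.1 hB
      simp only [Constraint.key.injEq] at hA hB
      rw [hA.2, hB.2]
  inst := inst

end Student

/-! ## A universal interpretation for positive graphs -/

/-! The mapping never expresses a key. Every triple it produces is a typing by a class, a domain or
range declaration, or a link whose predicate lies outside the reserved vocabulary. Such graphs are
purely positive, so a single OWL interpretation that makes every non-reserved IRI and every blank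
node denote one "full" resource `top` satisfies all of them. Hence every image is consistent
(`directMapping_consistent`), and any database violating its constraints refutes semantics
preservation; the two students with the same `SID` are one.

The work lies in exhibiting the interpretation. The RDF-based semantics states most axiom conditions
as equivalences, and it demands distinct literals, an empty `owl:Nothing` and an irreflexive
`owl:differentFrom`, so a one-point model is impossible. In the model `interp` every resource is a
class, a property and a literal value, which removes all typing side conditions. Lists and
restrictions are trivialised: `rdf:first`, `rdf:rest` and `owl:onProperty` have empty extensions, so
only the empty list exists and every restriction condition is vacuous.

There remain the properties that speak about properties (subproperty, domain, inverse, disjointness,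
functionality and so on), whose own extensions must be a fixed point of their definitions. The
choice is made so that one dichotomy governs everything: an `Inert` resource has empty property
extension, and any other has full class extension. Since `type` belongs to no proper class
extension, it is a universal test element (`type_mem_cext`). The 13 non-inert properties are
compared by evaluating them at a few sample pairs, which gives `subProp_iff`, `eqProp_iff`,
`inverse_iff`, `disjProp_iff`, `dom_iff`, `range_iff` and the characterisations of functional,
transitive and similar properties. -/

namespace OWLModel

open RDF.Vocab

/-- The resources: the literals, a class and property `top` with full extensions, a class and
property `bot` with empty extensions, the properties of the OWL semantics, and the classes of
properties with a given characteristic. -/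
inductive Res where
  | lit (l : Literal)
  | bot | top
  | type | subClass | subProp | dom | eqClass | disjClass | eqProp | disjProp | inverse
  | same | different | compl
  | functional | reflexive | irreflexive | symmetric | asymmetric | transitive

/-! ### Class and property extensions of the model. -/

namespace Res

instance : Nonempty Res := ⟨bot⟩

/-- The resources whose property extension is empty; all others have a full class extension. -/
def Inert : Res → Prop
  | lit _ | bot | functional | reflexive | irreflexive | symmetric | asymmetric | transitive => True
  | _ => False

/-- The resources with a symmetric property extension. -/
def Symm : Res → Prop
  | type | subClass | subProp | dom => False
  | _ => True

/-- Class extensions. -/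
def cext : Res → Set Res
  | lit _ | bot => ∅
  | functional => {x | x.Inert ∨ x = same}
  | reflexive => {x | match x with
      | top | subClass | subProp | dom | eqClass | eqProp | same => True
      | _ => False}
  | irreflexive => {x | x.Inert ∨ x = different ∨ x = compl}
  | symmetric => {x | x.Symm}
  | asymmetric => {x | x.Inert}
  | transitive => {x | x.Inert ∨ match x with
      | top | subClass | subProp | eqClass | eqProp | inverse | same => True
      | _ => False}
  | _ => Set.univ

/-- The proper inclusions between distinct nonempty property extensions other than that of `top`. -/
def Below : Res → Res → Prop
  | same, subClass | same, subProp | same, dom | same, eqClass | same, eqProp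
  | eqClass, subClass | eqClass, dom | eqProp, subProp | eqProp, dom
  | inverse, eqProp | inverse, subProp | inverse, dom | subProp, dom | subClass, dom
  | compl, different | compl, disjClass | compl, disjProp | disjClass, disjProp => True
  | _, _ => False

/-- The disjoint pairs of nonempty property extensions, up to symmetry. -/
def Apart : Res → Res → Prop
  | same, different | same, compl | eqClass, compl | eqProp, compl | inverse, compl => True
  | _, _ => False

/-- Property extensions. -/
def ext : Res → Res → Res → Prop
  | top, _, _ => True
  | type, x, c => x ∈ cext c
  | subClass, c, d => cext c ⊆ cext d
  | subProp, p, q => p.Inert ∨ q = top ∨ p = q ∨ Below p q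
  -- The last alternative is forced: only symmetric properties have an inverse here, so the
  -- extension of `inverse` lies in `symmetric` on both sides.
  | dom, p, c => p.Inert ∨ ¬ c.Inert ∨ (p = inverse ∧ c = symmetric)
  | eqClass, c, d => cext c = cext d
  | disjClass, c, d => Disjoint (cext c) (cext d)
  | eqProp, p, q => (p.Inert ∧ q.Inert) ∨ p = q
  | disjProp, p, q => p.Inert ∨ q.Inert ∨ Apart p q ∨ Apart q p
  -- The converses of `type`, `subClass`, `subProp` and `dom` are not the extension of any resource,
  -- so a nonempty property has an inverse only if it is its own.
  | inverse, p, q => (p.Inert ∧ q.Inert) ∨ (p = q ∧ p.Symm)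
  | same, x, y => x = y
  | different, x, y => x ≠ y
  | compl, c, d => cext c = (cext d)ᶜ
  | _, _, _ => False

/-! ### Class extensions -/

/-- Membership is functional in neither direction, nor reflexive, irreflexive, symmetric, asymmetric
or transitive, so `type` lies outside every characteristic class. One element thus detects whether a
class extension is full. -/
theorem type_mem_cext {c : Res} : type ∈ cext c ↔ ¬ c.Inert := by
  cases c <;> simp [cext, Inert, Symm]

theorem cext_eq_univ {c : Res} : cext c = Set.univ ↔ ¬ c.Inert := by
  refine ⟨fun h => type_mem_cext.1 (h ▸ Set.mem_univ _), fun h => ?_⟩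
  cases c <;> simp_all [cext, Inert]

theorem ext_of_inert {p : Res} (h : p.Inert) (x y : Res) : ¬ ext p x y := by
  cases p <;> simp_all [ext, Inert]

theorem ext_symm {p : Res} (h : p.Symm) {x y : Res} (hxy : ext p x y) : ext p y x := by
  cases p <;> simp_all [ext, Symm]
  case disjClass => exact hxy.symm
  case eqProp => tauto
  case disjProp => tauto
  case inverse =>
    rcases hxy with h | ⟨rfl, h⟩ <;> tauto
  case different => exact Ne.symm hxy

theorem Below.not_inert {p q : Res} (h : Below p q) : ¬ p.Inert ∧ ¬ q.Inert := by
  cases p <;> cases q <;> simp_all [Below, Inert]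

theorem empty_ne_univ : (∅ : Set Res) ≠ Set.univ := Set.empty_ne_univ

/-! ### Values of the property extensions at sample pairs -/

/-- The tables at the sample pairs reduce a universally quantified statement about extensions to a
finite case check. All but one of the failing inclusions between nonempty extensions, and all
failing disjointness, show up at one of these pairs. -/
theorem ext_type_type {p : Res} : ext p type type ↔
    match p with
    | top | type | subClass | subProp | dom | eqClass | eqProp | same => True
    | _ => False := by
  cases p <;> simp [ext, Inert, cext, Apart, Symm]

theorem ext_type_subClass {p : Res} : ext p type subClass ↔
    match p with
    | top | type | subClass | dom | eqClass | different => True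
    | _ => False := by
  cases p <;> simp [ext, Inert, cext, Apart, Below]

theorem ext_bot_bot {p : Res} : ext p bot bot ↔
    match p with
    | top | subClass | subProp | dom | eqClass | disjClass | eqProp | disjProp | inverse | same => True
    | _ => False := by
  cases p <;> simp [ext, Inert, cext, empty_ne_univ]

theorem ext_type_bot {p : Res} : ext p type bot ↔
    match p with
    | top | disjClass | disjProp | different | compl => True
    | _ => False := by
  cases p <;> simp [ext, Inert, cext, Below]

theorem ext_bot_type {p : Res} : ext p bot type ↔
    match p with
    | top | type | subClass | subProp | dom | disjClass | disjProp | different | compl => True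
    | _ => False := by
  cases p <;> simp [ext, Inert, cext, empty_ne_univ]

/-- The only sample pair that tells `type` from `dom` and from `subClass`: `top` is reflexive, but
the class `reflexive` is not full. -/
theorem ext_top_reflexive {p : Res} : ext p top reflexive ↔
    match p with
    | top | type | disjProp | different => True
    | _ => False := by
  have h : type ∉ cext reflexive := fun h => type_mem_cext.1 h trivial
  have h' : top ∈ cext reflexive := trivial
  have hu : cext top = Set.univ := rfl
  have hn : cext reflexive ≠ Set.univ := fun e => h (e ▸ Set.mem_univ _)
  have he : cext reflexive ≠ ∅ := fun e => (e ▸ h' : top ∈ (∅ : Set Res))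
  cases p <;> simp [ext, Inert, Below, h', hu, hn, hn.symm, he, Set.univ_subset_iff]
  exact fun e => (e ▸ Set.mem_univ top : top ∈ (cext reflexive)ᶜ) h'

theorem ext_functional_bot {p : Res} : ext p functional bot ↔
    match p with
    | top | subProp | dom | disjClass | eqProp | disjProp | inverse | different => True
    | _ => False := by
  have h : bot ∈ cext functional := Or.inl trivial
  have h' : type ∉ cext functional := fun h => type_mem_cext.1 h trivial
  have hb : cext bot = ∅ := rfl
  have hn : cext functional ≠ Set.univ := fun e => h' (e ▸ Set.mem_univ _)
  have he : cext functional ≠ ∅ := fun e => (e ▸ h : bot ∈ (∅ : Set Res))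
  cases p <;> simp [ext, Inert, hb, hn, he]

theorem ext_functional_functional {p : Res} : ext p functional functional ↔
    match p with
    | top | type | subClass | subProp | dom | eqClass | eqProp | disjProp | inverse | same => True
    | _ => False := by
  have h : bot ∈ cext functional := Or.inl trivial
  have h' : functional ∈ cext functional := Or.inl trivial
  have he : cext functional ≠ ∅ := fun e => (e ▸ h : bot ∈ (∅ : Set Res))
  cases p <;> simp [ext, Inert, h', he]

/-! ### Relations between property extensions -/

/-- Testing with `type`, inclusion of classes transports non-inertness, disjoint classes cannot both
be non-inert, and complementary classes are disjoint. Most cases then become propositional in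
inertness. -/
theorem ext_of_below {p q x y : Res} (h : Below p q) (hxy : ext p x y) : ext q x y := by
  have hs : ∀ {c d : Res}, cext c ⊆ cext d → ¬ c.Inert → ¬ d.Inert := fun h hc =>
    type_mem_cext.1 (h (type_mem_cext.2 hc))
  have hd : ∀ {c d : Res}, Disjoint (cext c) (cext d) → c.Inert ∨ d.Inert := fun {c d} h => by
    by_contra! hn
    exact Set.disjoint_left.1 h (type_mem_cext.2 hn.1) (type_mem_cext.2 hn.2)
  have hc : ∀ {c d : Res}, cext c = (cext d)ᶜ → Disjoint (cext c) (cext d) := fun h =>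
    h ▸ disjoint_compl_left
  have hb := @Below.not_inert x y
  have hi : ∀ c : Res, c.Inert ∨ ¬ c.Inert := fun c => em _
  cases p <;> cases q <;> simp only [Below] at h <;> simp only [ext] at hxy ⊢
  case compl.different =>
    rintro rfl
    have : type ∈ cext x ↔ type ∈ (cext x)ᶜ := by rw [← hxy]
    simp at this
  case compl.disjClass => exact hc hxy
  case compl.disjProp => have := hd (hc hxy); tauto
  case disjClass.disjProp => have := hd hxy; tauto
  case subClass.dom => have := @hs _ _ hxy; tauto
  case eqClass.dom => have := @hs _ _ hxy.subset; tauto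
  case eqClass.subClass => exact hxy.subset
  case same.subClass => rw [hxy]
  case same.eqClass => rw [hxy]
  case subProp.dom =>
    rcases hxy with h | rfl | rfl | h
    · exact Or.inl h
    · exact Or.inr (Or.inl id)
    · have := hi x; tauto
    · exact Or.inr (Or.inl (hb h).2)
  all_goals first | tauto | (have := hi x; rcases hxy with h | ⟨rfl, h⟩ <;> tauto)

theorem subProp_iff {p q : Res} :
    ext subProp p q ↔ ∀ x y, ext p x y → ext q x y := by
  constructor
  · rintro (h | rfl | rfl | h) x y hxy
    · exact absurd hxy (ext_of_inert h x y)
    · trivial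
    · exact hxy
    · exact ext_of_below h hxy
  · intro h
    have h₁ := h type type
    have h₂ := h type subClass
    have h₃ := h bot bot
    have h₄ := h type bot
    have h₅ := h bot type
    have h₆ := h top reflexive
    have h₇ := h functional bot
    have h₈ := h functional functional
    simp only [ext_type_type, ext_type_subClass, ext_bot_bot, ext_type_bot, ext_bot_type,
      ext_top_reflexive, ext_functional_bot, ext_functional_functional] at h₁ h₂ h₃ h₄ h₅ h₆ h₇ h₈
    by_cases hp : p.Inert
    · exact Or.inl hp
    cases p <;> first
      | exact absurd trivial hp
      | cases q <;> first
        | exact Or.inr (Or.inl rfl)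
        | exact Or.inr (Or.inr (Or.inl rfl))
        | exact Or.inr (Or.inr (Or.inr trivial))
        | exact (h₁ trivial).elim
        | exact (h₂ trivial).elim
        | exact (h₃ trivial).elim
        | exact (h₄ trivial).elim
        | exact (h₅ trivial).elim
        | exact (h₆ trivial).elim
        | exact (h₇ trivial).elim
        | exact (h₈ trivial).elim
        -- `inverse` against `disjProp` is the one pair that the samples leave open: `top` is its
        -- own inverse but is not disjoint from itself.
        | exact absurd (h top top (Or.inr ⟨rfl, trivial⟩)) (by simp [ext, Inert, Apart])

/-- Equality of extensions is inclusion both ways, and `Below` never holds in both directions. -/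
theorem eqProp_iff {p q : Res} : ext eqProp p q ↔ ∀ x y, ext p x y ↔ ext q x y := by
  have : (∀ x y, ext p x y ↔ ext q x y) ↔ ext subProp p q ∧ ext subProp q p := by
    rw [subProp_iff, subProp_iff]
    exact ⟨fun h => ⟨fun x y => (h x y).1, fun x y => (h x y).2⟩,
      fun h x y => ⟨h.1 x y, h.2 x y⟩⟩
  rw [this]
  cases p <;> cases q <;> simp [ext, Inert, Below]

/-- For symmetric `q`, being an inverse is the same as having an equal extension. Each non-symmetric
`q` contains (`bot`, `type`) but not its reversal, so an inverse would contain only the reversal; no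
extension does. -/
theorem inverse_iff {p q : Res} : ext inverse p q ↔ ∀ x y, ext p x y ↔ ext q y x := by
  by_cases hq : q.Symm
  · have h : ext inverse p q ↔ ext eqProp p q := by
      refine or_congr Iff.rfl (and_iff_left_of_imp ?_)
      rintro rfl
      exact hq
    rw [h, eqProp_iff]
    have : ∀ x y, ext q x y ↔ ext q y x := fun x y => ⟨ext_symm hq, ext_symm hq⟩
    exact forall₂_congr fun x y => by rw [this]
  · refine iff_of_false ?_ fun h => ?_
    · rintro (⟨-, h⟩ | ⟨rfl, h⟩)
      · cases q <;> simp_all [Inert, Symm]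
      · exact hq h
    · have h₁ := h bot type
      have h₂ := h type bot
      simp only [ext_type_bot, ext_bot_type] at h₁ h₂
      clear h
      cases q <;> first
        | exact absurd trivial hq
        | cases p <;> first
          | exact (h₂.2 trivial).elim
          | exact (h₁.1 trivial).elim

/-- Two equal or two inert resources agree on whether `type` belongs to their class extensions, so
these are never complementary. -/
theorem not_ext_of_apart {p q x y : Res} (h : Apart p q) (hp : ext p x y) : ¬ ext q x y := by
  have hc : ∀ {c d : Res}, (c.Inert ∧ d.Inert) ∨ c = d → cext c ≠ (cext d)ᶜ := by
    intro c d h e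
    have h' : type ∈ cext c ↔ type ∈ (cext d)ᶜ := by rw [e]
    simp only [type_mem_cext, Set.mem_compl_iff] at h'
    rcases h with h | rfl <;> tauto
  cases p <;> cases q <;> simp only [Apart] at h <;> simp only [ext] at hp ⊢
  case same.different => exact not_not.2 hp
  case same.compl => exact hc (Or.inr hp)
  case eqClass.compl =>
    intro e
    exact hc (Or.inr rfl) (hp ▸ e)
  case eqProp.compl => exact hc hp
  case inverse.compl => exact hc (hp.imp_right And.left)

theorem disjProp_iff {p q : Res} : ext disjProp p q ↔ ∀ x y, ¬ (ext p x y ∧ ext q x y) := by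
  constructor
  · rintro (h | h | h | h) x y ⟨hp, hq⟩
    · exact ext_of_inert h x y hp
    · exact ext_of_inert h x y hq
    · exact not_ext_of_apart h hp hq
    · exact not_ext_of_apart h hq hp
  · intro h
    have h₁ := h type type
    have h₂ := h type subClass
    have h₃ := h bot bot
    have h₄ := h type bot
    have h₅ := h bot type
    have h₇ := h functional bot
    have h₈ := h functional functional
    simp only [ext_type_type, ext_type_subClass, ext_bot_bot, ext_type_bot, ext_bot_type,
      ext_functional_bot, ext_functional_functional] at h₁ h₂ h₃ h₄ h₅ h₇ h₈
    clear h
    by_cases hp : p.Inert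
    · exact Or.inl hp
    by_cases hq : q.Inert
    · exact Or.inr (Or.inl hq)
    cases p <;> first
      | exact absurd trivial hp
      | cases q <;> first
        | exact absurd trivial hq
        | exact Or.inr (Or.inr (Or.inl trivial))
        | exact Or.inr (Or.inr (Or.inr trivial))
        | exact (h₁ ⟨trivial, trivial⟩).elim
        | exact (h₂ ⟨trivial, trivial⟩).elim
        | exact (h₃ ⟨trivial, trivial⟩).elim
        | exact (h₄ ⟨trivial, trivial⟩).elim
        | exact (h₅ ⟨trivial, trivial⟩).elim
        | exact (h₇ ⟨trivial, trivial⟩).elim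
        | exact (h₈ ⟨trivial, trivial⟩).elim

/-- `inverse` is excluded because `type` is neither inert nor symmetric, hence has no inverse. For
the others, a domain or range must contain `type` and is therefore full. -/
theorem exists_ext_type {p : Res} (h : ¬ p.Inert) (h' : p ≠ inverse) :
    (∃ y, ext p type y) ∧ ∃ x, ext p x type := by
  by_cases h₁ : ext p type type
  · exact ⟨⟨_, h₁⟩, ⟨_, h₁⟩⟩
  · have h₂ : ext p type bot ∧ ext p bot type := by
      rw [ext_type_bot, ext_bot_type]
      rw [ext_type_type] at h₁
      cases p <;> simp_all [Inert]
    exact ⟨⟨_, h₂.1⟩, ⟨_, h₂.2⟩⟩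

theorem symm_of_inert {p : Res} (h : p.Inert) : p.Symm := by
  cases p <;> simp_all [Inert, Symm]

/-- `disjClass` is symmetric but has none of the other characteristics. -/
theorem cext_symmetric_subset {c : Res} (h : {x : Res | x.Symm} ⊆ cext c) :
    ¬ c.Inert ∨ c = symmetric := by
  have h₁ : disjClass ∈ cext c := h trivial
  cases c <;> simp_all [cext, Inert]

theorem dom_iff {p c : Res} : ext dom p c ↔ ∀ x y, ext p x y → x ∈ cext c := by
  constructor
  · rintro (h | h | ⟨rfl, rfl⟩) x y hxy
    · exact absurd hxy (ext_of_inert h x y)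
    · rw [cext_eq_univ.2 h]; trivial
    · rcases hxy with h | h
      · exact symm_of_inert h.1
      · exact h.2
  · intro h
    by_cases hp : p.Inert
    · exact Or.inl hp
    by_cases hi : p = inverse
    · subst hi
      have := cext_symmetric_subset fun x (hx : x.Symm) => h x x (Or.inr ⟨rfl, hx⟩)
      exact Or.inr (this.imp_right fun h => ⟨rfl, h⟩)
    · obtain ⟨⟨y, hy⟩, -⟩ := exists_ext_type hp hi
      exact Or.inr (Or.inl (type_mem_cext.1 (h _ _ hy)))

/-- Domain and range can share one denotation: `inverse`, the only property with a proper nonempty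
domain, is symmetric, and every other non-inert property has `type` in both its domain and its
range. -/
theorem range_iff {p c : Res} : ext dom p c ↔ ∀ x y, ext p x y → y ∈ cext c := by
  constructor
  · intro h x y hxy
    by_cases hc : c.Inert
    · rcases h with h | h | ⟨rfl, rfl⟩
      · exact absurd hxy (ext_of_inert h x y)
      · exact absurd hc h
      · exact dom_iff.1 (Or.inr (Or.inr ⟨rfl, rfl⟩)) y x (ext_symm (p := inverse) trivial hxy)
    · rw [cext_eq_univ.2 hc]; trivial
  · intro h
    by_cases hp : p.Inert
    · exact Or.inl hp
    by_cases hi : p = inverse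
    · subst hi
      exact dom_iff.2 fun x y hxy => h y x (ext_symm (p := inverse) trivial hxy)
    · obtain ⟨-, x, hx⟩ := exists_ext_type hp hi
      exact Or.inr (Or.inl (type_mem_cext.1 (h _ _ hx)))

/-! ### Characteristics of property extensions -/

theorem functional_iff {p : Res} :
    p ∈ cext functional ↔ ∀ x y z, ext p x y → ext p x z → y = z := by
  constructor
  · rintro (h | rfl) x y z hy hz
    · exact absurd hy (ext_of_inert h x y)
    · exact hy.symm.trans hz
  · intro h
    have h₁ := h bot bot type
    have h₂ := h type type subClass
    have h₃ := h functional functional bot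
    have h₄ := h type subClass bot
    simp only [ext_bot_bot, ext_bot_type, ext_type_type, ext_type_subClass,
      ext_functional_functional, ext_functional_bot, ext_type_bot] at h₁ h₂ h₃ h₄
    cases p <;> first
      | exact Or.inl trivial
      | exact Or.inr rfl
      | exact absurd (h₁ trivial trivial) nofun
      | exact absurd (h₂ trivial trivial) nofun
      | exact absurd (h₃ trivial trivial) nofun
      | exact absurd (h₄ trivial trivial) nofun
      -- This is for `compl`: the full class has several complements, since `bot` and all literals
      -- have empty class extension.
      | exact absurd (h type bot (lit (.nat 0)) Set.compl_empty.symm Set.compl_empty.symm) nofun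

/-- One class serves both notions: they agree on symmetric properties, and each non-symmetric one
relates both `bot` and `type` to `type`. -/
theorem inverseFunctional_iff {p : Res} :
    p ∈ cext functional ↔ ∀ x y z, ext p x z → ext p y z → x = y := by
  by_cases hp : p.Symm
  · rw [functional_iff]
    exact ⟨fun h x y z hx hy => h z x y (ext_symm hp hx) (ext_symm hp hy),
      fun h x y z hy hz => h y z x (ext_symm hp hy) (ext_symm hp hz)⟩
  · refine iff_of_false (fun h => ?_) fun h => ?_
    · rcases h with h | rfl
      · exact hp (symm_of_inert h)
      · exact hp trivial
    · have h₁ := h bot type type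
      simp only [ext_type_type, ext_bot_type] at h₁
      cases p <;> simp_all [Symm]

theorem reflexive_iff {p : Res} : p ∈ cext reflexive ↔ ∀ x, ext p x x := by
  constructor
  · intro h x
    have : x.Inert ∨ ¬ x.Inert := em _
    cases p <;> simp_all [cext, ext]
    tauto
  · intro h
    have h₁ := h type
    have h₂ := h bot
    simp only [ext_type_type, ext_bot_bot] at h₁ h₂
    clear h
    cases p <;> simp_all [cext]

theorem irreflexive_iff {p : Res} : p ∈ cext irreflexive ↔ ∀ x, ¬ ext p x x := by
  constructor
  · rintro (h | rfl | rfl) x hx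
    · exact ext_of_inert h x x hx
    · exact hx rfl
    · have : type ∈ cext x ↔ type ∈ (cext x)ᶜ := iff_of_eq (congrArg (type ∈ ·) hx)
      simp at this
  · intro h
    have h₁ := h type
    have h₂ := h bot
    simp only [ext_type_type, ext_bot_bot] at h₁ h₂
    clear h
    cases p <;> simp_all [cext, Inert]

theorem symmetric_iff {p : Res} : p ∈ cext symmetric ↔ ∀ x y, ext p x y → ext p y x := by
  refine ⟨fun h x y hxy => ext_symm h hxy, fun h => ?_⟩
  have h₁ := h bot type
  simp only [ext_bot_type, ext_type_bot] at h₁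
  clear h
  cases p <;> simp_all [cext, Symm]

theorem asymmetric_iff {p : Res} : p ∈ cext asymmetric ↔ ∀ x y, ext p x y → ¬ ext p y x := by
  refine ⟨fun h x y hxy => absurd hxy (ext_of_inert h x y), fun h => ?_⟩
  have h₁ := h type type
  have h₂ := h bot bot
  have h₃ := h type bot
  simp only [ext_bot_type, ext_type_bot, ext_type_type, ext_bot_bot] at h₁ h₂ h₃
  clear h
  cases p <;> first
    | exact trivial
    | exact absurd trivial (h₁ trivial)
    | exact absurd trivial (h₂ trivial)
    | exact absurd trivial (h₃ trivial)

theorem transitive_iff {p : Res} :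
    p ∈ cext transitive ↔ ∀ x y z, ext p x y → ext p y z → ext p x z := by
  constructor
  · rintro (h | h) x y z hxy hyz
    · exact absurd hxy (ext_of_inert h x y)
    · cases p <;> simp only at h
      case top => trivial
      case subClass => exact Set.Subset.trans hxy hyz
      case subProp =>
        rw [subProp_iff] at *
        exact fun a b hab => hyz a b (hxy a b hab)
      case eqClass => exact Eq.trans hxy hyz
      case eqProp =>
        rw [eqProp_iff] at *
        exact fun a b => (hxy a b).trans (hyz a b)
      case inverse =>
        rcases hxy with hxy | ⟨rfl, -⟩
        · rcases hyz with hyz | ⟨rfl, -⟩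
          · exact Or.inl ⟨hxy.1, hyz.2⟩
          · exact Or.inl hxy
        · exact hyz
      case same => exact Eq.trans hxy hyz
  · intro h
    have h₁ := h type bot type
    -- Refutes transitivity of `type`: `bot` is in `top` and `top` is in `reflexive`, but `bot` is
    -- not in `reflexive`.
    have h₂ := h bot top reflexive
    -- Refutes transitivity of `dom`: `inverse` is a full class, hence a domain of `type`, and
    -- `symmetric` is a domain of `inverse` but not of `type`.
    have h₃ := h type inverse symmetric
    simp only [ext_type_bot, ext_bot_type, ext_type_type] at h₁
    cases p <;> simp_all [cext, ext, Inert]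

end Res

open Res

/-! ### The interpretation -/

/-- Denotations of the reserved vocabulary. -/
def den : Vocab → Res
  | rdfType => .type
  | rdfsSubClassOf => .subClass
  | rdfsSubPropertyOf => .subProp
  | rdfsDomain | rdfsRange => .dom
  -- The only list is `rdf:nil`, which denotes `top`. An empty intersection is the full class, so it
  -- is equivalence with `top`.
  | owlEquivalentClass | owlIntersectionOf => .eqClass
  | owlDisjointWith => .disjClass
  | owlEquivalentProperty => .eqProp
  | owlPropertyDisjointWith => .disjProp
  | owlInverseOf => .inverse
  | owlSameAs => .same
  | owlDifferentFrom => .different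
  -- Dually, empty unions and enumerations are empty, so they are complementation to `top`.
  | owlComplementOf | owlDatatypeComplementOf | owlUnionOf | owlOneOf | owlDisjointUnionOf => .compl
  | owlFunctionalProperty | owlInverseFunctionalProperty => .functional
  | owlReflexiveProperty => .reflexive
  | owlIrreflexiveProperty => .irreflexive
  | owlSymmetricProperty => .symmetric
  | owlAsymmetricProperty => .asymmetric
  | owlTransitiveProperty => .transitive
  | rdfFirst | rdfRest | owlNothing | owlBottomDataProperty | owlBottomObjectProperty
  | owlOnProperty | owlAssertionProperty | owlCardinality | owlMinCardinality | owlMaxCardinality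
  | owlQualifiedCardinality | owlMinQualifiedCardinality | owlMaxQualifiedCardinality => .bot
  | _ => .top

/-- The interpretation in which every IRI outside the reserved vocabulary denotes `top`, and all
resources are classes, properties and literal values. -/
def interp : Interp where
  R := Res
  IP := Set.univ
  LV := Set.univ
  ext := ext
  ext_IP _ _ _ _ := trivial
  iri
    | .vocab v => den v
    | .other _ => .top
  lit := .lit
  lit_injective _ _ h := Res.lit.inj h
  lit_LV _ := trivial

/-- `rdf:first` denotes `bot`, so no list has a first element. -/
theorem eq_nil_of_isSeq {s : interp.R} {l : List interp.R} (h : interp.IsSeq s l) :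
    s = interp.den rdfNil ∧ l = [] := by
  cases h with
  | nil => exact ⟨rfl, rfl⟩
  | cons h => exact h.elim

theorem classSub (v : Vocab) : interp.ClassSub v Set.univ := ⟨trivial, Set.subset_univ _⟩

theorem classEq {v : Vocab} (h : ¬ (den v).Inert) : interp.ClassEq v Set.univ :=
  ⟨trivial, cext_eq_univ.2 h⟩

theorem propSub (v : Vocab) : interp.PropSub v Set.univ Set.univ :=
  ⟨trivial, fun _ _ _ => ⟨trivial, trivial⟩⟩

/-- Needed for the cardinality properties: their range, the nonnegative integers, is not the whole
universe, so their extensions must be empty. -/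
theorem propSub_of_inert {v : Vocab} (h : (den v).Inert) (S T : Set interp.R) :
    interp.PropSub v S T :=
  ⟨trivial, fun _ _ hxy => absurd hxy (ext_of_inert h _ _)⟩

theorem not_inert_of_mem {v w : Vocab} {l : List (Vocab × Vocab)} (h : (v, w) ∈ l)
    (hl : ∀ q ∈ l, ¬ (den q.2).Inert) : ¬ (den w).Inert :=
  hl _ h

/-! ### Verification of the OWL 2 conditions. -/

theorem rdfsConditions : interp.RDFSConditions where
  axiomatic s p o h := by
    cases h with
    | property h => trivial
    | membership n => trivial
    | nil => trivial
    | domain h =>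
      exact Or.inr (Or.inl (not_inert_of_mem h (by simp [den, Inert])))
    | range h => exact Or.inr (Or.inl (not_inert_of_mem h (by simp [den, Inert])))
    | subClass h =>
      exact (Set.subset_univ _).trans
        (cext_eq_univ.2 (not_inert_of_mem h (by simp [den, Inert]))).superset
    | isDefinedBy => exact subProp_iff.2 fun _ _ h => h
    | membershipType n => trivial
    | membershipDomain n => exact Or.inr (Or.inl id)
    | membershipRange n => exact Or.inr (Or.inl id)
  property := rfl
  resource := rfl
  literal := rfl
  membership _ _ := subProp_iff.2 fun _ _ _ => trivial
  datatype _ _ := Set.subset_univ _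

theorem classConditions : interp.ClassConditions := by
  constructor
  case cNothing => exact ⟨trivial, rfl⟩
  all_goals first
    | exact classSub _
    | exact classEq id

theorem propertyConditions : interp.PropertyConditions := by
  constructor
  case pBottomDataProperty => exact ⟨trivial, fun _ _ => id⟩
  case pBottomObjectProperty => exact ⟨trivial, fun _ _ => id⟩
  case pTopDataProperty => exact ⟨trivial, fun _ _ => Iff.rfl⟩
  case pTopObjectProperty => exact ⟨trivial, fun _ _ => trivial⟩
  all_goals first
    | exact propSub _
    | exact propSub_of_inert (by trivial) _ _
    | exact ⟨propSub _, trivial⟩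

theorem univ_iff {p : Prop} : (True ∧ True ∧ p) ↔ p := by simp

theorem expressionConditions : interp.ExpressionConditions := by
  -- Every restriction condition assumes an `owl:onProperty` triple, so this settles all of them.
  have hb : ∀ z p : Res, ¬ interp.P owlOnProperty z p := fun _ _ => id
  constructor
  case complementOf => exact fun z c => univ_iff.symm
  case datatypeComplementOf =>
    intro z d
    have : interp.LV \ interp.cext d = (interp.cext d)ᶜ := (Set.compl_eq_univ_sdiff _).symm
    rw [this]
    exact univ_iff.symm
  case intersectionOf =>
    intro z s l h
    obtain ⟨rfl, rfl⟩ := eq_nil_of_isSeq h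
    have : {x | ∀ c ∈ ([] : List interp.R), x ∈ interp.cext c} = Set.univ := by simp
    rw [this]
    exact ⟨fun h => ⟨trivial, by simp, h⟩, fun h => h.2.2⟩
  case unionOf =>
    intro z s l h
    obtain ⟨rfl, rfl⟩ := eq_nil_of_isSeq h
    have : {x | ∃ c ∈ ([] : List interp.R), x ∈ interp.cext c} = (Set.univᶜ : Set interp.R) := by simp
    rw [this]
    exact ⟨fun h => ⟨trivial, by simp, h⟩, fun h => h.2.2⟩
  case oneOf =>
    intro z s l h
    obtain ⟨rfl, rfl⟩ := eq_nil_of_isSeq h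
    have : {x | x ∈ ([] : List interp.R)} = (Set.univᶜ : Set interp.R) := by simp
    rw [this]
    exact ⟨fun h => ⟨trivial, h⟩, fun h => h.2⟩
  all_goals
    intros
    exact absurd ‹interp.P owlOnProperty _ _› (hb _ _)

theorem axiomConditions : interp.AxiomConditions := by
  constructor
  case subClassOf => exact fun c d => univ_iff.symm
  case subPropertyOf => exact fun p q => subProp_iff.trans univ_iff.symm
  case domain => exact fun p c => dom_iff.trans univ_iff.symm
  case range => exact fun p c => range_iff.trans univ_iff.symm
  case equivalentClass => exact fun c d => univ_iff.symm
  case disjointWith => exact fun c d => univ_iff.symm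
  case equivalentProperty => exact fun p q => eqProp_iff.trans univ_iff.symm
  case propertyDisjointWith => exact fun p q => disjProp_iff.trans univ_iff.symm
  case disjointUnionOf =>
    intro z s l h
    obtain ⟨rfl, rfl⟩ := eq_nil_of_isSeq h
    have : {x | ∃ c ∈ ([] : List interp.R), x ∈ interp.cext c} = (Set.univᶜ : Set interp.R) := by simp
    rw [this]
    exact ⟨fun h => ⟨trivial, by simp, h, List.Pairwise.nil⟩, fun h => h.2.2.1⟩
  case inverseOf => exact fun p q => inverse_iff.trans univ_iff.symm
  case functional => exact fun p => functional_iff.trans (and_iff_right trivial).symm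
  case inverseFunctional => exact fun p => inverseFunctional_iff.trans (and_iff_right trivial).symm
  case reflexive => exact fun p => reflexive_iff.trans (and_iff_right trivial).symm
  case irreflexive => exact fun p => irreflexive_iff.trans (and_iff_right trivial).symm
  case symmetric => exact fun p => symmetric_iff.trans (and_iff_right trivial).symm
  case asymmetric => exact fun p => asymmetric_iff.trans (and_iff_right trivial).symm
  case transitive => exact fun p => transitive_iff.trans (and_iff_right trivial).symm
  case sameAs => exact fun _ _ => Iff.rfl
  case differentFrom => exact fun _ _ => Iff.rfl
  case propertyChain => exact fun _ _ _ h hl => absurd (eq_nil_of_isSeq h).2 hl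
  case hasKey => exact fun _ _ _ h hl => absurd (eq_nil_of_isSeq h).2 hl
  case negativeAssertion => exact fun _ _ _ _ _ h => absurd h id
  -- The conditions left concern members of a list, and the empty list meets them trivially.
  all_goals
    intro z s l h
    obtain ⟨rfl, rfl⟩ := eq_nil_of_isSeq h
    simp

theorem interp_isOWL : interp.IsOWL :=
  ⟨rdfsConditions, classConditions, propertyConditions, expressionConditions, axiomConditions⟩

end OWLModel

/-- The image of every database under the direct mapping is consistent: all its triples are
assertions about the vocabulary terms for types, domains and ranges. -/
theorem directMapping_consistent (base : Str) (ι : TupleIds) (X : Database) :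
    (directMapping base ι X).OWLConsistent := by
  refine ⟨OWLModel.interp, OWLModel.interp_isOWL, fun _ => .top, fun t ht => ?_⟩
  change DM.IsTriple X base ι t at ht
  -- Domain and range triples have `top` on both sides, and the class `top` is full. The other
  -- triples are typings by a full class or have a predicate denoting `top`.
  have hd : OWLModel.Res.ext .dom .top .top := Or.inr (Or.inl id)
  cases ht with
  | objDomain => exact hd
  | objRange => exact hd
  | dataDomain => exact hd
  | _ => trivial

/-! ### Violation of the key in the example. -/

namespace Student

theorem not_sat : ¬ database.Sat := by
  intro h
  have hk : inst.SatKey sSTUDENT [sSID] := h _ (Finset.mem_singleton_self _)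
  have hn : sNAME ≠ sSID := by decide
  have hr : inst.rel sSTUDENT = tuples := by simp [inst]; rfl
  have h₁ : tuple sJohn ∈ inst.rel sSTUDENT := by rw [hr]; exact Finset.mem_insert_self _ _
  have h₂ : tuple sPeter ∈ inst.rel sSTUDENT := by rw [hr]; exact Finset.mem_insert_of_mem (Finset.mem_singleton_self _)
  have e := hk.2 _ h₁ _ h₂ fun a ha => by
    obtain rfl := List.mem_singleton.1 ha
    simp [Tuple.val, tuple]
  -- The tuples agree on `SID`, so the key would identify them; comparing at `NAME` gives the
  -- contradiction.
  have e' : some sJohn = some sPeter := by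
    simpa [tuple, hn] using congrFun e ⟨sNAME, by simp⟩
  exact absurd e' (by decide)

end Student

/-- The direct mapping is not semantics preserving; the example database violates its primary key,
but its image is consistent under OWL semantics. -/
theorem proposition1 (base : Str) (ι : TupleIds) :
    ¬ SemanticsPreserving (directMapping base ι) ∧
    ¬ Student.database.Sat ∧
    (directMapping base ι Student.database).OWLConsistent :=
  ⟨fun h => Student.not_sat ((h Student.database).2 (directMapping_consistent base ι _)),
    Student.not_sat, directMapping_consistent base ι _⟩
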